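/- **Setting.** Let $P=\{y\in\mathbb R^n : l_k(y):=\langle y,v_k\rangle-\lambda_k\ge 0,\ k=1,\dots,d\}$ be a Delzant polytope: compact, with non-empty interior, each $l_k$ vanishing somewhere on $P$, and such that at every vertex the normals $v_k\in\mathbb Z^n$ of the facets $\{l_k=0\}$ through it form a basis of $\mathbb Z^n$. Put $u_G=\sum_k l_k\log l_k$. Let $\psi_0\in C^\infty(\mathbb R^n)$ be the open-orbit potential of a torus-invariant Kähler metric: its Hessian is positive definite everywhere, $\overline{\operatorname{Im}\nabla\psi_0}=P$, and its symplectic potential, the Legendre transform $u_0=\psi_0^*$, satisfies $u_0=u_G+F$ on $P$ with $F\in C^\infty(P)$ (smooth up to the boundary). Let $\dot\psi_0:\mathbb R^n\to\mathbb R$ be an initial velocity such that $\dot u_0:=-\dot\psi_0\circ(\nabla\psi_0)^{-1}$ extends to a function in $C^\infty(P)$. Define $$T_{\rm span}^{\rm cvx}:=\sup\{s\ge 0:\ \psi_0^*-s\,\dot\psi_0\circ(\nabla\psi_0)^{-1}\text{ is convex on }\operatorname{Im}\nabla\psi_0\}\in[0,\infty]$$ and $\psi(s,x):=(u_0+s\dot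 u_0)^*(x)=\sup_{y\in P}\big(\langle x,y\rangle-u_0(y)-s\dot u_0(y)\big)$, considered on $[0,\infty)\times\mathbb R^n$ (the same formula defines $\psi$ for $s<0$; differentiability and subdifferentials at $s=0$ are taken for this extension to $\mathbb R\times\mathbb R^n$). For a set $A$ let $(\mathrm{MA}\,\psi)(A)$ be the Lebesgue measure in $\mathbb R^{n+1}$ of $\partial\psi(A)=\bigcup_{p\in A}\partial\psi(p)$, where $\partial\psi$ is the subdifferential in $(s,x)$. Let $\Delta(\psi)\subset[0,\infty)\times\mathbb R^n$ be the set of points at which $\psi$ is finite and differentiable, and $\Sigma_{\rm sing}(T):=\big([0,T]\times\mathbb R^n\big)\setminus\Delta(\psi)$. **Theorem 1.** The function $\psi$ is finite everywhere and convex, and: (i) $\psi$ solves the Cauchy problem for the homogeneous real Monge–Ampère equation on its regular locus: $\psi(0,\cdot)=\psi_0$, $\frac{\partial\psi}{\partial s}(0,\cdot)=\dot\psi_0$ (one-sided derivative), and $\mathrm{MA}\,\psi=0$ on $\Delta(\psi)$. In addition, $[0,T_{\rm span}^{\rm cvx})\times\mathbb R^n\subset\Delta(\psi)$. (ii) For every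 $T>T_{\rm span}^{\rm cvx}$, $\psi$ is not a weak solution on $[0,T]\times\mathbb R^n$ of the Cauchy problem $\mathrm{MA}\,\psi=0$, $\psi(0,\cdot)=\psi_0$, $\frac{\partial\psi}{\partial s}(0,\cdot)=\dot\psi_0$; in fact $$\int_{[0,T]\times\mathbb R^n}\mathrm{MA}\,\psi=\int_{\Sigma_{\rm sing}(T)}\mathrm{MA}\,\psi>0 .$$ -/

import Mathlib

open Set Filter Topology MeasureTheory
open scoped ContDiff

/-! Delzant polytopes -/

/-- Integral normals `v k` and offsets `lam k` of finitely many affine functions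
`l k y = ⟨v k, y⟩ - lam k` on `ℝⁿ`. -/
structure FacetData (n : ℕ) where
  d : ℕ
  v : Fin d → Fin n → ℤ
  lam : Fin d → ℝ

namespace FacetData

variable {n : ℕ}

/-- The affine function `l k y = ⟨v k, y⟩ - lam k`. -/
def l (D : FacetData n) (k : Fin D.d) (y : EuclideanSpace ℝ (Fin n)) : ℝ :=
  (∑ i, (D.v k i : ℝ) * y i) - D.lam k

/-- The polyhedron `P = {y | l k y ≥ 0 for all k}`. -/
def polytope (D : FacetData n) : Set (EuclideanSpace ℝ (Fin n)) :=
  {y | ∀ k, 0 ≤ D.l k y}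

/-- `P` is a Delzant polytope with facets `{l k = 0}`: it is a compact polytope with non-empty
interior, every `l k` vanishes somewhere on `P`, and at every vertex the normals of the facets
through this vertex form a basis of the lattice `ℤⁿ`. -/
structure IsDelzant (D : FacetData n) : Prop where
  compact : IsCompact D.polytope
  interior_nonempty : (interior D.polytope).Nonempty
  facet_nonempty : ∀ k, ∃ y ∈ D.polytope, D.l k y = 0
  vertex_linearIndependent : ∀ p ∈ D.polytope.extremePoints ℝ,
    LinearIndependent ℤ (fun k : {k : Fin D.d // D.l k p = 0} => D.v k)
  vertex_span : ∀ p ∈ D.polytope.extremePoints ℝ,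
    Submodule.span ℤ (Set.range (fun k : {k : Fin D.d // D.l k p = 0} => D.v k)) = ⊤

/-- Guillemin's potential `u_G = ∑ k, l k * log (l k)` (with `0 * log 0 = 0`). -/
noncomputable def guillemin (D : FacetData n) (y : EuclideanSpace ℝ (Fin n)) : ℝ :=
  ∑ k, D.l k y * Real.log (D.l k y)

end FacetData

/-! Convex analysis and the Cauchy data -/

/-- The Legendre transform `f^*(x) = sup_y (⟨x, y⟩ - f y)` of an extended real valued function. -/
noncomputable def legendre {n : ℕ} (f : EuclideanSpace ℝ (Fin n) → EReal)
    (x : EuclideanSpace ℝ (Fin n)) : EReal :=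
  ⨆ y, ((inner ℝ x y : ℝ) : EReal) - f y

/-- The symplectic potential `u₀ = ψ₀^*`; it takes the value `+∞` off the polytope. -/
noncomputable def symplecticPotential {n : ℕ} (ψ₀ : EuclideanSpace ℝ (Fin n) → ℝ) :
    EuclideanSpace ℝ (Fin n) → EReal :=
  legendre (fun x => (ψ₀ x : EReal))

/-- `ψ₀` is the potential, on the open orbit and in logarithmic coordinates, of a torus invariant
Kähler metric on the toric manifold with moment polytope `P`: it is smooth with positive definite
Hessian, the closure of the image of its gradient is `P`, and its symplectic potential is
`u_G + F` on `P`, with `F` smooth up to the boundary of `P`. -/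
structure IsToricKahlerPotential {n : ℕ} (D : FacetData n)
    (ψ₀ : EuclideanSpace ℝ (Fin n) → ℝ) : Prop where
  smooth : ContDiff ℝ ∞ ψ₀
  hessian_pos : ∀ x w, w ≠ 0 → 0 < fderiv ℝ (fderiv ℝ ψ₀) x w w
  closure_range_gradient : closure (Set.range (gradient ψ₀)) = D.polytope
  guillemin_form : ∃ F : EuclideanSpace ℝ (Fin n) → ℝ, ContDiffOn ℝ ∞ F D.polytope ∧
    ∀ y ∈ D.polytope, symplecticPotential ψ₀ y = ((D.guillemin y + F y : ℝ) : EReal)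

/-- `ψ₀'` is a smooth torus invariant initial velocity on the open orbit and `u₀'` is the
corresponding velocity of symplectic potentials: `u₀'` is smooth up to the boundary of `P`, and
`u₀' = -ψ₀' ∘ (∇ψ₀)⁻¹` on the image of `∇ψ₀`. -/
structure IsInitialVelocity {n : ℕ} (D : FacetData n)
    (ψ₀ ψ₀' u₀' : EuclideanSpace ℝ (Fin n) → ℝ) : Prop where
  smooth : ContDiffOn ℝ ∞ u₀' D.polytope
  transform : ∀ x, u₀' (gradient ψ₀ x) = -ψ₀' x

/-- The convex lifespan: the supremum of all `s ≥ 0` for which `ψ₀^* - s ψ₀' ∘ (∇ψ₀)⁻¹` is convex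
on the image of `∇ψ₀`. -/
noncomputable def convexLifespan {n : ℕ} (ψ₀ ψ₀' : EuclideanSpace ℝ (Fin n) → ℝ) : EReal :=
  sSup ((fun s : ℝ => (s : EReal)) '' {s : ℝ | 0 ≤ s ∧
    ConvexOn ℝ (Set.range (gradient ψ₀)) (fun y =>
      (symplecticPotential ψ₀ y).toReal - s * ψ₀' (Function.invFun (gradient ψ₀) y))})

/-- The Legendre transform potential `ψ(s, x) = (u₀ + s u₀')^*(x)`. The formula makes sense for
every real `s`. (As `u₀ = +∞` off `P`, the values of `u₀'` off `P` play no role.) -/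
noncomputable def legendrePotential {n : ℕ} (ψ₀ u₀' : EuclideanSpace ℝ (Fin n) → ℝ)
    (p : ℝ × EuclideanSpace ℝ (Fin n)) : EReal :=
  legendre (fun y => symplecticPotential ψ₀ y + ((p.1 * u₀' y : ℝ) : EReal)) p.2

/-! The real Monge-Ampère measure -/

/-- The subdifferential at `p` of a function on `ℝ × ℝⁿ`, a subset of the dual `ℝ × ℝⁿ`. -/
def subdiff {n : ℕ} (f : ℝ × EuclideanSpace ℝ (Fin n) → EReal)
    (p : ℝ × EuclideanSpace ℝ (Fin n)) : Set (ℝ × EuclideanSpace ℝ (Fin n)) :=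
  {w | f p ≠ ⊤ ∧ f p ≠ ⊥ ∧ ∀ z : ℝ × EuclideanSpace ℝ (Fin n),
    f p + ((w.1 * (z.1 - p.1) + inner ℝ w.2 (z.2 - p.2) : ℝ) : EReal) ≤ f z}

/-- The real Monge-Ampère measure (in the sense of Alexandrov) of a set: the Lebesgue measure in
`ℝ × ℝⁿ` of the image of the set under the subdifferential. -/
noncomputable def mongeAmpere {n : ℕ} (f : ℝ × EuclideanSpace ℝ (Fin n) → EReal)
    (A : Set (ℝ × EuclideanSpace ℝ (Fin n))) : ENNReal :=
  volume (⋃ p ∈ A, subdiff f p)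

/-- The regular locus `Δ(f)`: the points of `[0, ∞) × ℝⁿ` at which `f` is finite and
differentiable. -/
def regularLocus {n : ℕ} (f : ℝ × EuclideanSpace ℝ (Fin n) → EReal) :
    Set (ℝ × EuclideanSpace ℝ (Fin n)) :=
  {p | 0 ≤ p.1 ∧ (∀ᶠ q in 𝓝 p, f q ≠ ⊤ ∧ f q ≠ ⊥) ∧
    DifferentiableAt ℝ (fun q => (f q).toReal) p}

/-- The part of the singular locus with `s ≤ T`. -/
def singularLocus {n : ℕ} (f : ℝ × EuclideanSpace ℝ (Fin n) → EReal) (T : ℝ) :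
    Set (ℝ × EuclideanSpace ℝ (Fin n)) :=
  (Set.Ici 0 ×ˢ Set.univ \ regularLocus f) ∩ Set.Icc 0 T ×ˢ Set.univ

/-- `f` has the initial value `ψ₀` and the initial velocity `ψ₀'`. -/
def HasCauchyData {n : ℕ} (f : ℝ × EuclideanSpace ℝ (Fin n) → EReal)
    (ψ₀ ψ₀' : EuclideanSpace ℝ (Fin n) → ℝ) : Prop :=
  ∀ x, f (0, x) = (ψ₀ x : EReal) ∧
    HasDerivWithinAt (fun s : ℝ => (f (s, x)).toReal) (ψ₀' x) (Set.Ici 0) 0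

/-- `f` is a weak solution on `[0, T] × ℝⁿ` of the Cauchy problem for the homogeneous real
Monge-Ampère equation. -/
def IsWeakSolution {n : ℕ} (f : ℝ × EuclideanSpace ℝ (Fin n) → EReal)
    (ψ₀ ψ₀' : EuclideanSpace ℝ (Fin n) → ℝ) (T : ℝ) : Prop :=
  mongeAmpere f (Set.Icc 0 T ×ˢ Set.univ) = 0 ∧ HasCauchyData f ψ₀ ψ₀'

/-!
The Legendre potential `ψ(s, x)` is the maximum over the compact polytope `P` of the functions
`⟨x, y⟩ - u₀ y - s u₀' y`, affine in `(s, x)` with slope `(-u₀' y, y)`. Hence it is finite and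
convex, and by Danskin's theorem (`IsPairingSup.hasFDerivAt_of_unique`) it is differentiable
wherever the maximizer `y` is unique. Conversely, at a point of differentiability the slope of a
maximizer is the only subgradient, so that the subgradients over the regular locus lie in the
graph of `-u₀'`, which is a null set (`mongeAmpere_regularLocus`).

The singularity of Guillemin's potential along the facets forces every maximizer into the interior
of `P` (`FacetData.IsDelzant.mem_interior_of_isMinOn`). This identifies the image of `∇ψ₀` with
the interior of `P` without the inverse function theorem
(`IsToricKahlerPotential.range_gradient`). The potential `u₀` is strictly convex there, so for `s`
below the convex lifespan `u₀ + s u₀'` is strictly convex, and the maximizer is unique. At `s = 0`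
the unique maximizer is `∇ψ₀ x`, which gives the Cauchy data.

Beyond the lifespan, at time `T`, the function `u₀ + T u₀'` fails to be convex, so it lies
strictly above its convex envelope on a nonempty open set of `y`. For such `y` the convex function
`s ↦ inf_x (ψ(s, x) - ⟨x, y⟩)` has the value `-u₀ y` at `s = 0`, never falls below the line of
slope `-u₀' y` from there, and is strictly above it at time `T`. Every slope `σ` slightly larger
than `-u₀' y` is therefore attained as a subgradient in the slab
(`IsPairingSup.exists_subgradient`): the sections over `y` of the set of subgradients contain
intervals, and this set has positive measure (`mongeAmpere_slab_pos`). As the regular locus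
contributes nothing, the mass sits on the singular locus.
-/

/-! ### First-order convexity and affine minorants -/

section Generic

variable {G : Type*} [NormedAddCommGroup G] [NormedSpace ℝ G]

/-- An affine minorant touching `f` at a point of differentiability is the tangent: subgradients
are unique there. -/
theorem fderiv_eq_of_affine_le {f : G → ℝ} {p : G} (hf : DifferentiableAt ℝ f p) {ℓ : G →L[ℝ] ℝ}
    (h : ∀ z, f p + ℓ (z - p) ≤ f z) : fderiv ℝ f p = ℓ := by
  have hmin : IsLocalMin (fun z => f z - ℓ z) p :=
    Filter.Eventually.of_forall fun z => by
      have := h z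
      rw [map_sub] at this
      linarith
  have hd := (hf.hasFDerivAt.sub ℓ.hasFDerivAt)
  exact sub_eq_zero.1 (hmin.hasFDerivAt_eq_zero hd)

theorem add_fderiv_le_of_fderiv_fderiv_nonneg {f : G → ℝ} (hf : ContDiff ℝ ∞ f)
    (hpos : ∀ x w, 0 ≤ fderiv ℝ (fderiv ℝ f) x w w) (x z : G) :
    f x + fderiv ℝ f x (z - x) ≤ f z := by
  have hline : ∀ t : ℝ, HasDerivAt (fun t : ℝ => x + t • (z - x)) (z - x) t := fun t => by
    simpa using ((hasDerivAt_id t).smul_const (z - x)).const_add x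
  have hf1 : Differentiable ℝ f := hf.differentiable (by simp)
  have hf2 : Differentiable ℝ (fderiv ℝ f) :=
    (hf.fderiv_right (m := 1) (by norm_cast)).differentiable (by simp)
  have h1 : ∀ t : ℝ, HasDerivAt (fun t : ℝ => f (x + t • (z - x)))
      (fderiv ℝ f (x + t • (z - x)) (z - x)) t := fun t =>
    (hf1 _).hasFDerivAt.comp_hasDerivAt t (hline t)
  have h2 : ∀ t : ℝ, HasDerivAt (fun t : ℝ => fderiv ℝ f (x + t • (z - x)) (z - x))
      (fderiv ℝ (fderiv ℝ f) (x + t • (z - x)) (z - x) (z - x)) t := fun t =>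
    (((hf2 _).hasFDerivAt.comp_hasDerivAt t (hline t)).clm_apply
      (hasDerivAt_const t (z - x))).congr_deriv (by simp)
  have hconv : ConvexOn ℝ univ (fun t : ℝ => f (x + t • (z - x))) := by
    refine convexOn_univ_of_deriv2_nonneg (fun t => (h1 t).differentiableAt) ?_ ?_
    · rw [funext fun t => (h1 t).deriv]
      exact fun t => (h2 t).differentiableAt
    · intro t
      rw [Function.iterate_succ, Function.iterate_one, Function.comp_apply,
        funext fun t => (h1 t).deriv, (h2 t).deriv]
      exact hpos _ _
  have := hconv.le_slope_of_hasDerivAt (mem_univ 0) (mem_univ 1) one_pos (h1 0)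
  simp [slope_def_field] at this
  rw [map_sub]
  linarith

end Generic

/-! ### Suprema of affine functions over a compact set of slopes -/

section Envelope

variable {E : Type*} [NormedAddCommGroup E] [InnerProductSpace ℝ E]

/-- The function `⟨x, y⟩ - u y - s v y`, whose supremum over `y` at `p = (s, x)` is the Legendre
transform of `u + s v` at `x`. -/
noncomputable def pairing (u v : E → ℝ) (p : ℝ × E) (y : E) : ℝ :=
  inner ℝ p.2 y - (u y + p.1 * v y)

/-- The linear part of `pairing u v · y`, that is, the functional `(s, x) ↦ -v y * s + ⟨y, x⟩`
with the vector of coefficients `(-v y, y)`. -/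
noncomputable def pairingSlope (v : E → ℝ) (y : E) : ℝ × E →L[ℝ] ℝ :=
  -(v y) • ContinuousLinearMap.fst ℝ ℝ E + (innerSL ℝ y).comp (ContinuousLinearMap.snd ℝ ℝ E)

theorem pairingSlope_apply (v : E → ℝ) (y : E) (p : ℝ × E) :
    pairingSlope v y p = -(v y) * p.1 + inner ℝ y p.2 := by
  simp [pairingSlope]

theorem pairing_eq_add_slope (u v : E → ℝ) (p q : ℝ × E) (y : E) :
    pairing u v q y = pairing u v p y + pairingSlope v y (q - p) := by
  simp only [pairing, pairingSlope_apply, Prod.fst_sub, Prod.snd_sub, inner_sub_right,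
    real_inner_comm y]
  ring

/-- `f (s, x)` is the maximum over `y ∈ P` of `⟨x, y⟩ - u y - s v y`. Attainment is part of the
definition, so no junk value of a supremum enters. -/
structure IsPairingSup (P : Set E) (u v : E → ℝ) (f : ℝ × E → ℝ) : Prop where
  exists_eq : ∀ p, ∃ y ∈ P, f p = pairing u v p y
  le : ∀ p, ∀ y ∈ P, pairing u v p y ≤ f p

variable {P : Set E} {u v : E → ℝ} {f : ℝ × E → ℝ}

theorem continuousOn_pairing (hu : ContinuousOn u P) (hv : ContinuousOn v P) :
    ContinuousOn (fun q : (ℝ × E) × E => pairing u v q.1 q.2) (univ ×ˢ P) := by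
  have hs : MapsTo (Prod.snd : (ℝ × E) × E → E) (univ ×ˢ P) P := fun q hq => hq.2
  have h1 := hu.comp continuous_snd.continuousOn hs
  have h2 := hv.comp continuous_snd.continuousOn hs
  refine ContinuousOn.sub (by fun_prop) (h1.add (ContinuousOn.mul (by fun_prop) h2))

namespace IsPairingSup

/-- Every maximizer at `p` provides a subgradient at `p`. -/
theorem add_slope_le (hf : IsPairingSup P u v f) {p : ℝ × E} {y : E} (hy : y ∈ P)
    (hp : f p = pairing u v p y) (q : ℝ × E) : f p + pairingSlope v y (q - p) ≤ f q := by
  rw [hp, ← pairing_eq_add_slope]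
  exact hf.le q y hy

theorem convexOn (hf : IsPairingSup P u v f) : ConvexOn ℝ univ f := by
  refine ⟨convex_univ, fun p _ q _ a b ha hb hab => ?_⟩
  obtain ⟨y, hy, h⟩ := hf.exists_eq (a • p + b • q)
  have h1 := hf.le p y hy
  have h2 := hf.le q y hy
  have : pairing u v (a • p + b • q) y = a * pairing u v p y + b * pairing u v q y := by
    simp only [pairing, Prod.fst_add, Prod.snd_add, Prod.smul_fst, Prod.smul_snd, inner_add_left,
      real_inner_smul_left, smul_eq_mul]
    linear_combination u y * hab
  rw [h, this, smul_eq_mul, smul_eq_mul]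
  gcongr

/-- Danskin's theorem: where the maximizer is unique, the supremum is differentiable, and its
derivative is that of the maximizing affine function. Maximizers at nearby points converge to the
unique one by compactness, and they give matching bounds on the increment of `f`. -/
theorem hasFDerivAt_of_unique (hf : IsPairingSup P u v f) (hP : IsCompact P)
    (hu : ContinuousOn u P) (hv : ContinuousOn v P) {p : ℝ × E} {y : E} (hy : y ∈ P)
    (hp : f p = pairing u v p y) (huniq : ∀ z ∈ P, f p = pairing u v p z → z = y) :
    HasFDerivAt f (pairingSlope v y) p := by
  choose m hmP hm using hf.exists_eq
  have hlim : Tendsto m (𝓝 p) (𝓝[P] y) := by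
    refine tendsto_iff_ultrafilter _ _ _ |>.2 fun 𝒰 h𝒰 => ?_
    obtain ⟨z, hzP, hz⟩ := hP.ultrafilter_le_nhds (𝒰.map m)
      (tendsto_principal.2 (Filter.Eventually.of_forall hmP))
    have hmz : Tendsto m 𝒰 (𝓝[P] z) :=
      tendsto_nhdsWithin_iff.2 ⟨hz, Filter.Eventually.of_forall hmP⟩
    have hid : Tendsto (fun q : ℝ × E => q) 𝒰 (𝓝 p) := h𝒰
    have key : ∀ w ∈ P, pairing u v p w ≤ pairing u v p z := fun w hw => by
      have hA := continuousOn_pairing hu hv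
      have t1 : Tendsto (fun q : ℝ × E => pairing u v q (m q)) 𝒰 (𝓝 (pairing u v p z)) :=
        (hA (p, z) ⟨mem_univ _, hzP⟩).tendsto.comp (by
          rw [nhdsWithin_prod_eq, nhdsWithin_univ]
          exact hid.prodMk hmz)
      have t2 : Tendsto (fun q : ℝ × E => pairing u v q w) 𝒰 (𝓝 (pairing u v p w)) :=
        (hA (p, w) ⟨mem_univ _, hw⟩).tendsto.comp (by
          rw [nhdsWithin_prod_eq, nhdsWithin_univ]
          exact hid.prodMk (tendsto_nhdsWithin_iff.2
            ⟨tendsto_const_nhds, Filter.Eventually.of_forall fun _ => hw⟩))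
      exact le_of_tendsto_of_tendsto' t2 t1 fun q => (hm q).symm ▸ hf.le q w hw
    have hzy : z = y := huniq z hzP (le_antisymm (hp ▸ key y hy) (hf.le p z hzP))
    exact hzy ▸ hmz
  have hv' : Tendsto (fun q => |v (m q) - v y| + ‖m q - y‖) (𝓝 p) (𝓝 0) := by
    have hc : ContinuousOn (fun z => |v z - v y| + ‖z - y‖) P := by fun_prop
    simpa [Function.comp_def] using (hc y hy).tendsto.comp hlim
  rw [hasFDerivAt_iff_isLittleO, Asymptotics.isLittleO_iff]
  intro c hc
  filter_upwards [hv'.eventually_lt_const hc] with q hq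
  have h1 := hf.add_slope_le hy hp q
  have h2 := hf.add_slope_le (hmP q) (hm q) p
  rw [← neg_sub q p, map_neg] at h2
  rw [Real.norm_of_nonneg (by linarith)]
  have h3 : |(v y - v (m q)) * (q - p).1| ≤ |v (m q) - v y| * ‖q - p‖ := by
    rw [abs_mul, abs_sub_comm]
    exact mul_le_mul_of_nonneg_left (norm_fst_le (q - p)) (abs_nonneg _)
  have h4 : |inner ℝ (m q - y) (q - p).2| ≤ ‖m q - y‖ * ‖q - p‖ :=
    (abs_real_inner_le_norm _ _).trans
      (mul_le_mul_of_nonneg_left (norm_snd_le (q - p)) (norm_nonneg _))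
  calc f q - f p - pairingSlope v y (q - p)
      ≤ (v y - v (m q)) * (q - p).1 + inner ℝ (m q - y) (q - p).2 := by
        simp only [pairingSlope_apply, inner_sub_left] at h2 ⊢
        linarith
    _ ≤ (|v (m q) - v y| + ‖m q - y‖) * ‖q - p‖ := by
        linarith [le_of_abs_le h3, le_of_abs_le h4]
    _ ≤ c * ‖q - p‖ := by gcongr

end IsPairingSup

/-- Coercivity: if `a` dominates `⟨x, z⟩ - g z` for `z` in a set containing a ball of radius `r`
around `y`, and `g ≤ C` there, then `a - ⟨x, y⟩ ≥ r ‖x‖ - C`. The test point is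
`y + r x / ‖x‖` (which is `y` when `x = 0`). -/
theorem norm_bound_of_closedBall {P : Set E} {g : E → ℝ} {C r : ℝ} {x y : E} (hr : 0 ≤ r)
    (hball : Metric.closedBall y r ⊆ P) {a : ℝ} (hg : ∀ z ∈ P, g z ≤ C)
    (ha : ∀ z ∈ P, inner ℝ x z - g z ≤ a) : r * ‖x‖ - C ≤ a - inner ℝ x y := by
  have hz : y + (r * ‖x‖⁻¹) • x ∈ P := hball (by
    rw [Metric.mem_closedBall, dist_self_add_left, norm_smul, norm_mul, norm_inv, norm_norm,
      Real.norm_of_nonneg hr, mul_assoc]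
    exact mul_le_of_le_one_right hr (inv_mul_le_one))
  have h1 := ha _ hz
  have h2 := hg _ hz
  rw [inner_add_right, real_inner_smul_right, real_inner_self_eq_norm_sq] at h1
  have : r * ‖x‖⁻¹ * ‖x‖ ^ 2 = r * ‖x‖ := by
    rcases eq_or_ne ‖x‖ 0 with h | h
    · simp [h]
    · field_simp
  linarith

/-- If `σ` is at least the initial slope `-v y`, and the line of slope `σ` from the value `-u y`
at time `0` stays below all values of `f (T, x) - ⟨x, y⟩` at time `T`, then `(σ, y)` is a
subgradient of `f` at some point of the slab `[0, T] × E`. The point is a minimizer of `f - σ s -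
⟨x, y⟩` over the slab, which exists by coercivity and turns out to be global: for `s < 0` because
`-v y ≤ σ`, for `s > T` by convexity along the segment from `(0, x₀)`. -/
theorem IsPairingSup.exists_subgradient [FiniteDimensional ℝ E] (hf : IsPairingSup P u v f)
    (hP : IsCompact P) (hu : ContinuousOn u P) (hv : ContinuousOn v P) {y x₀ : E}
    (hy : y ∈ interior P) (hx₀ : f (0, x₀) = pairing u v (0, x₀) y) {T σ : ℝ} (hT : 0 < T)
    (hσ : -v y ≤ σ) (henv : ∀ x, T * σ - u y ≤ f (T, x) - inner ℝ x y) :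
    ∃ p ∈ Icc 0 T ×ˢ (univ : Set E), ∀ q,
      f p + (σ * (q.1 - p.1) + inner ℝ y (q.2 - p.2)) ≤ f q := by
  have hcont : Continuous f := by
    simpa using hf.convexOn.continuousOn isOpen_univ
  set h : ℝ × E → ℝ := fun p => f p - σ * p.1 - inner ℝ p.2 y with hh
  have hhc : Continuous h := by fun_prop
  have h0 : h (0, x₀) = -u y := by simp [hh, hx₀, pairing]
  obtain ⟨r, hr, hball⟩ := Metric.nhds_basis_closedBall.mem_iff.1 (mem_interior_iff_mem_nhds.1 hy)
  obtain ⟨Cu, hCu⟩ := hP.exists_bound_of_continuousOn hu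
  obtain ⟨Cv, hCv⟩ := hP.exists_bound_of_continuousOn hv
  have hyP := interior_subset hy
  have hCv0 : 0 ≤ Cv := (norm_nonneg _).trans (hCv y hyP)
  have hlow : ∀ p : ℝ × E, p.1 ∈ Icc 0 T → r * ‖p.2‖ - (Cu + T * Cv) - T * |σ| ≤ h p := by
    rintro ⟨s, x⟩ ⟨hs0, hsT⟩
    have := norm_bound_of_closedBall hr.le hball (x := x) (g := fun z => u z + s * v z)
      (C := Cu + T * Cv) (a := f (s, x)) (fun z hz => by
        have h1 := (le_abs_self _).trans (hCu z hz)
        have h2 := (le_abs_self _).trans (hCv z hz)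
        have : s * v z ≤ T * Cv := (mul_le_mul_of_nonneg_left h2 hs0).trans
          (mul_le_mul_of_nonneg_right hsT hCv0)
        linarith) (fun z hz => hf.le (s, x) z hz)
    have h3 : σ * s ≤ T * |σ| := by
      have := mul_le_mul_of_nonneg_right (le_abs_self σ) hs0
      have := mul_le_mul_of_nonneg_left hsT (abs_nonneg σ)
      linarith
    simp only [hh]
    linarith
  obtain ⟨p, hp, hmin⟩ := hhc.continuousOn.exists_isMinOn' (s := Icc 0 T ×ˢ (univ : Set E))
    (isClosed_Icc.prod isClosed_univ) (x₀ := (0, x₀)) ⟨⟨le_rfl, hT.le⟩, mem_univ _⟩ (by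
      have hK : IsCompact (Icc 0 T ×ˢ Metric.closedBall (0 : E)
          ((-u y + (Cu + T * Cv) + T * |σ|) / r)) :=
        isCompact_Icc.prod (isCompact_closedBall _ _)
      filter_upwards [mem_inf_of_left hK.compl_mem_cocompact,
        mem_inf_of_right (mem_principal_self _)]
        with q hq hq'
      have : ¬ ‖q.2‖ ≤ (-u y + (Cu + T * Cv) + T * |σ|) / r := fun hle =>
        hq ⟨hq'.1, by simpa using hle⟩
      rw [le_div_iff₀ hr, not_le] at this
      have := hlow q hq'.1
      rw [h0]
      linarith)
  have hglob : ∀ q, h p ≤ h q := by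
    rintro ⟨s, x⟩
    have hp0 : h p ≤ -u y := h0 ▸ hmin ⟨⟨le_rfl, hT.le⟩, mem_univ _⟩
    rcases lt_or_ge s 0 with hs | hs
    · have h1 := hf.le (s, x) y hyP
      simp only [pairing] at h1
      have : 0 ≤ (-s) * (σ + v y) := mul_nonneg (by linarith) (by linarith)
      simp only [hh] at hp0 ⊢
      linarith
    rcases le_or_gt s T with hsT | hsT
    · exact hmin (⟨⟨hs, hsT⟩, mem_univ _⟩ : (s, x) ∈ Icc 0 T ×ˢ (univ : Set E))
    · have hs' : 0 < s := hT.trans hsT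
      have hb : T / s ≤ 1 := (div_le_one hs').2 hsT.le
      have hc := hf.convexOn.2 (mem_univ (0, x₀)) (mem_univ (s, x)) (sub_nonneg.2 hb)
        (div_pos hT hs').le (by ring)
      have he : (1 - T / s) • ((0 : ℝ), x₀) + (T / s) • (s, x)
          = (T, (1 - T / s) • x₀ + (T / s) • x) := by
        ext1
        · simp [hs'.ne']
        · simp
      rw [he, hx₀] at hc
      have hd := henv ((1 - T / s) • x₀ + (T / s) • x)
      simp only [pairing, inner_add_left, real_inner_smul_left, smul_eq_mul] at hc hd
      simp only [hh] at hp0 ⊢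
      have h4 : T / s * (σ * s) = T * σ := by field_simp
      have h3 : (T / s) * (-u y) ≤ (T / s) * (f (s, x) - σ * s - inner ℝ x y) := by
        linarith
      have := le_of_mul_le_mul_left h3 (div_pos hT hs')
      linarith
  refine ⟨p, hp, fun q => ?_⟩
  have := hglob q
  simp only [hh] at this
  rw [inner_sub_right, real_inner_comm q.2, real_inner_comm p.2]
  linarith

end Envelope

/-! ### Guillemin's potential on the polytope -/

namespace FacetData

variable {n : ℕ} {D : FacetData n}

theorem continuous_l (D : FacetData n) (k : Fin D.d) : Continuous (D.l k) := by
  unfold l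
  fun_prop

theorem l_add_smul_sub (D : FacetData n) (k : Fin D.d) (y z : EuclideanSpace ℝ (Fin n)) (t : ℝ) :
    D.l k (y + t • (z - y)) = (1 - t) * D.l k y + t * D.l k z := by
  simp only [l, PiLp.add_apply, PiLp.smul_apply, PiLp.sub_apply, smul_eq_mul]
  have : ∀ i, (D.v k i : ℝ) * (y i + t * (z i - y i))
      = (1 - t) * ((D.v k i : ℝ) * y i) + t * ((D.v k i : ℝ) * z i) := fun i => by ring
  simp only [this, Finset.sum_add_distrib, ← Finset.mul_sum]
  ring

theorem convex_polytope (D : FacetData n) : Convex ℝ D.polytope := by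
  rw [convex_iff_add_mem]
  intro y hy z hz a b ha hb hab k
  have h := D.l_add_smul_sub k y z b
  rw [show y + b • (z - y) = a • y + b • z by
    rw [← eq_sub_iff_add_eq] at hab; rw [hab]; module] at h
  rw [h, ← hab, add_sub_cancel_right]
  exact add_nonneg (mul_nonneg ha (hy k)) (mul_nonneg hb (hz k))

theorem continuous_guillemin (D : FacetData n) : Continuous D.guillemin :=
  continuous_finsetSum _ fun k _ => Real.continuous_mul_log.comp (D.continuous_l k)

namespace IsDelzant

theorem normal_ne_zero (hD : D.IsDelzant) (k : Fin D.d) : D.v k ≠ 0 := by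
  intro h
  obtain ⟨y, hy, hk⟩ := hD.facet_nonempty k
  obtain ⟨p, hp⟩ := hD.compact.extremePoints_nonempty ⟨y, hy⟩
  have hkp : D.l k p = 0 := by
    simpa [l, h] using hk
  exact (hD.vertex_linearIndependent p hp).ne_zero ⟨k, hkp⟩ h

theorem l_pos_of_mem_interior (hD : D.IsDelzant) {y : EuclideanSpace ℝ (Fin n)}
    (hy : y ∈ interior D.polytope) (k : Fin D.d) : 0 < D.l k y := by
  set w : EuclideanSpace ℝ (Fin n) := WithLp.toLp 2 fun i => (D.v k i : ℝ) with hw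
  have hcont : Tendsto (fun t : ℝ => y - t • w) (𝓝[>] 0) (𝓝 y) := by
    have : Continuous fun t : ℝ => y - t • w := by fun_prop
    simpa using (this.tendsto 0).mono_left nhdsWithin_le_nhds
  obtain ⟨t, ht, ht0⟩ := ((hcont.eventually (mem_interior_iff_mem_nhds.1 hy)).and
    self_mem_nhdsWithin).exists
  have h := ht k
  have hl : D.l k (y - t • w) = D.l k y - t * ∑ i, (D.v k i : ℝ) ^ 2 := by
    simp only [l, hw, PiLp.sub_apply, PiLp.smul_apply, smul_eq_mul, mul_sub,
      Finset.sum_sub_distrib, Finset.mul_sum]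
    have : ∀ i, (D.v k i : ℝ) * (t * (D.v k i : ℝ)) = t * (D.v k i : ℝ) ^ 2 := fun i => by ring
    simp only [this]
    ring
  obtain ⟨i, hi⟩ := Function.ne_iff.1 (hD.normal_ne_zero k)
  have hpos : 0 < ∑ i, (D.v k i : ℝ) ^ 2 :=
    Finset.sum_pos' (fun i _ => sq_nonneg _)
      ⟨i, Finset.mem_univ _, sq_pos_of_ne_zero (Int.cast_ne_zero.2 hi)⟩
  have := mul_pos (show (0 : ℝ) < t from ht0) hpos
  linarith

/-- The logarithmic singularity of Guillemin's potential pushes minimizers into the interior: at a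
boundary point its derivative in any inward direction is `-∞`, and a perturbation that is
differentiable up to the boundary cannot compensate for this. -/
theorem mem_interior_of_isMinOn (hD : D.IsDelzant) {g : EuclideanSpace ℝ (Fin n) → ℝ}
    (hg : DifferentiableOn ℝ g D.polytope) {y : EuclideanSpace ℝ (Fin n)} (hy : y ∈ D.polytope)
    (hmin : ∀ z ∈ D.polytope, D.guillemin y + g y ≤ D.guillemin z + g z) :
    y ∈ interior D.polytope := by
  obtain ⟨z, hz⟩ := hD.interior_nonempty
  have hzP := interior_subset hz
  by_contra hyi
  obtain ⟨k, hk⟩ : ∃ k, D.l k y = 0 := by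
    by_contra! h
    refine hyi (mem_interior.2 ⟨⋂ k, {x | 0 < D.l k x}, fun x hx k => ?_, ?_, ?_⟩)
    · exact (mem_iInter.1 hx k).le
    · exact isOpen_iInter_of_finite fun k => isOpen_lt continuous_const (D.continuous_l k)
    · exact mem_iInter.2 fun k => (hy k).lt_of_ne' (h k)
  have hb : 0 < D.l k z := hD.l_pos_of_mem_interior hz k
  set H : ℝ → ℝ := fun c => c * Real.log c with hH
  -- Convexity of `c log c` bounds all difference quotients; the `k`-th one has an extra `log t`.
  have hG : ∀ t ∈ Ioc (0 : ℝ) 1, D.guillemin (y + t • (z - y)) - D.guillemin y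
      ≤ t * ((∑ j, (H (D.l j z) - H (D.l j y))) + D.l k z * Real.log t) := by
    rintro t ⟨ht0, ht1⟩
    have hj : ∀ j, H (D.l j (y + t • (z - y))) - H (D.l j y)
        ≤ t * (H (D.l j z) - H (D.l j y)) + (if j = k then t * (D.l k z * Real.log t) else 0) := by
      intro j
      rw [l_add_smul_sub]
      split_ifs with hjk
      · subst hjk
        simp only [hH, hk]
        rw [mul_zero, zero_add, Real.log_mul ht0.ne' hb.ne']
        apply le_of_eq
        ring
      · have := Real.convexOn_mul_log.2 (hy j) (hzP j) (sub_nonneg.2 ht1) ht0.le (by ring)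
        simp only [smul_eq_mul] at this
        simp only [hH]
        linarith
    calc _ = ∑ j, (H (D.l j (y + t • (z - y))) - H (D.l j y)) := by
          rw [Finset.sum_sub_distrib]; rfl
      _ ≤ _ := Finset.sum_le_sum fun j _ => hj j
      _ = _ := by
          rw [Finset.sum_add_distrib, ← Finset.mul_sum, Finset.sum_ite_eq' Finset.univ k]
          simp
          ring
  have hseg : MapsTo (fun t : ℝ => y + t • (z - y)) (Ioc 0 1) D.polytope := fun t ht =>
    D.convex_polytope.add_smul_sub_mem hy hzP ⟨ht.1.le, ht.2⟩
  have hline : HasDerivWithinAt (fun t : ℝ => y + t • (z - y)) (z - y) (Ioc 0 1) 0 := by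
    simpa using (((hasDerivAt_id (0 : ℝ)).smul_const (z - y)).const_add y).hasDerivWithinAt
  have hgd := (hg y hy).hasFDerivWithinAt
  have hder : HasDerivWithinAt (fun t : ℝ => g (y + t • (z - y)))
      (fderivWithin ℝ g D.polytope y (z - y)) (Ioc 0 1) 0 :=
    HasFDerivWithinAt.comp_hasDerivWithinAt (t := D.polytope) (0 : ℝ)
      (by simpa using hgd) hline hseg
  rw [hasDerivWithinAt_iff_tendsto_slope' (by simp), nhdsWithin_Ioc_eq_nhdsGT one_pos] at hder
  have hlog : Tendsto (fun t : ℝ => (∑ j, (H (D.l j z) - H (D.l j y))) + D.l k z * Real.log t)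
      (𝓝[>] 0) atBot :=
    tendsto_atBot_add_const_left _ _ (Real.tendsto_log_nhdsGT_zero.const_mul_atBot hb)
  obtain ⟨t, ⟨h1, h2⟩, ht⟩ := (((hder.eventually_lt_const (lt_add_one _)).and
    (hlog.eventually_lt_atBot (-(fderivWithin ℝ g D.polytope y (z - y) + 1)))).and
    (Ioc_mem_nhdsGT one_pos)).exists
  have h3 := hG t ht
  have h4 := hmin _ (hseg ht)
  rw [slope_def_field, sub_zero, zero_smul, add_zero, div_lt_iff₀ ht.1] at h1
  have h5 := mul_lt_mul_of_pos_left h2 ht.1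
  linarith

end IsDelzant

end FacetData

/-! ### The symplectic potential -/

namespace IsToricKahlerPotential

variable {n : ℕ} {D : FacetData n} {ψ₀ : EuclideanSpace ℝ (Fin n) → ℝ}

theorem differentiable (h : IsToricKahlerPotential D ψ₀) : Differentiable ℝ ψ₀ :=
  h.smooth.differentiable (by simp)

theorem gradient_mem (h : IsToricKahlerPotential D ψ₀) (x : EuclideanSpace ℝ (Fin n)) :
    gradient ψ₀ x ∈ D.polytope :=
  h.closure_range_gradient ▸ subset_closure (mem_range_self x)

theorem add_inner_gradient_le (h : IsToricKahlerPotential D ψ₀)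
    (x z : EuclideanSpace ℝ (Fin n)) : ψ₀ x + inner ℝ (gradient ψ₀ x) (z - x) ≤ ψ₀ z := by
  rw [inner_gradient_left]
  refine add_fderiv_le_of_fderiv_fderiv_nonneg h.smooth (fun x w => ?_) x z
  rcases eq_or_ne w 0 with rfl | hw
  · simp
  · exact (h.hessian_pos x w hw).le

theorem eq_gradient_of_affine_le (h : IsToricKahlerPotential D ψ₀)
    {x y : EuclideanSpace ℝ (Fin n)} (hy : ∀ z, ψ₀ x + inner ℝ y (z - x) ≤ ψ₀ z) :
    y = gradient ψ₀ x := by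
  have := fderiv_eq_of_affine_le (h.differentiable x) (ℓ := innerSL ℝ y) (by simpa using hy)
  refine ext_inner_right ℝ fun w => ?_
  rw [inner_gradient_left, this, innerSL_apply_apply]

end IsToricKahlerPotential

theorem coe_sub_le_symplecticPotential {n : ℕ} (ψ₀ : EuclideanSpace ℝ (Fin n) → ℝ)
    (y x : EuclideanSpace ℝ (Fin n)) :
    ((inner ℝ y x - ψ₀ x : ℝ) : EReal) ≤ symplecticPotential ψ₀ y := by
  rw [EReal.coe_sub]
  exact le_iSup (fun x => ((inner ℝ y x : ℝ) : EReal) - (ψ₀ x : EReal)) x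

/-- The symplectic potential as a real function. It is meaningful on the polytope only: off the
polytope the symplectic potential is `⊤`, and the value here is the junk value `0`. -/
noncomputable def realPotential {n : ℕ} (ψ₀ : EuclideanSpace ℝ (Fin n) → ℝ)
    (y : EuclideanSpace ℝ (Fin n)) : ℝ :=
  (symplecticPotential ψ₀ y).toReal

namespace IsToricKahlerPotential

variable {n : ℕ} {D : FacetData n} {ψ₀ : EuclideanSpace ℝ (Fin n) → ℝ}

theorem coe_realPotential (h : IsToricKahlerPotential D ψ₀) {y : EuclideanSpace ℝ (Fin n)}
    (hy : y ∈ D.polytope) : symplecticPotential ψ₀ y = (realPotential ψ₀ y : EReal) := by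
  obtain ⟨F, -, hF⟩ := h.guillemin_form
  rw [realPotential, hF y hy, EReal.toReal_coe]

theorem exists_realPotential_eq (h : IsToricKahlerPotential D ψ₀) :
    ∃ F : EuclideanSpace ℝ (Fin n) → ℝ, ContDiffOn ℝ ∞ F D.polytope ∧
      ∀ y ∈ D.polytope, realPotential ψ₀ y = D.guillemin y + F y := by
  obtain ⟨F, hF', hF⟩ := h.guillemin_form
  exact ⟨F, hF', fun y hy => by rw [realPotential, hF y hy, EReal.toReal_coe]⟩

theorem continuousOn_realPotential (h : IsToricKahlerPotential D ψ₀) :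
    ContinuousOn (realPotential ψ₀) D.polytope := by
  obtain ⟨F, hF', hF⟩ := h.exists_realPotential_eq
  exact (D.continuous_guillemin.continuousOn.add hF'.continuousOn).congr hF

theorem inner_sub_le_realPotential (h : IsToricKahlerPotential D ψ₀)
    {y : EuclideanSpace ℝ (Fin n)} (hy : y ∈ D.polytope) (x : EuclideanSpace ℝ (Fin n)) :
    inner ℝ y x - ψ₀ x ≤ realPotential ψ₀ y := by
  have := coe_sub_le_symplecticPotential ψ₀ y x
  rw [h.coe_realPotential hy] at this
  exact_mod_cast this

theorem realPotential_gradient (h : IsToricKahlerPotential D ψ₀)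
    (x : EuclideanSpace ℝ (Fin n)) :
    realPotential ψ₀ (gradient ψ₀ x) = inner ℝ (gradient ψ₀ x) x - ψ₀ x := by
  refine le_antisymm ?_ (h.inner_sub_le_realPotential (h.gradient_mem x) x)
  rw [← EReal.coe_le_coe_iff, ← h.coe_realPotential (h.gradient_mem x)]
  refine iSup_le fun z => ?_
  rw [← EReal.coe_sub, EReal.coe_le_coe_iff]
  have := h.add_inner_gradient_le x z
  rw [inner_sub_right] at this
  linarith

/-- Equality in the Fenchel inequality `⟨y, x⟩ ≤ ψ₀ x + u₀ y` forces `y = ∇ψ₀ x`. -/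
theorem eq_gradient_of_realPotential_eq (h : IsToricKahlerPotential D ψ₀)
    {x y : EuclideanSpace ℝ (Fin n)} (hy : y ∈ D.polytope)
    (hxy : realPotential ψ₀ y = inner ℝ y x - ψ₀ x) : y = gradient ψ₀ x :=
  h.eq_gradient_of_affine_le fun z => by
    have := h.inner_sub_le_realPotential hy z
    rw [inner_sub_right]
    linarith

/-- Off the polytope the supremum defining `ψ₀^*` diverges along a ray whose direction separates
the point from the polytope, since `∇ψ₀` takes values in the polytope. -/
theorem symplecticPotential_eq_top (h : IsToricKahlerPotential D ψ₀) (hD : D.IsDelzant)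
    {y : EuclideanSpace ℝ (Fin n)} (hy : y ∉ D.polytope) : symplecticPotential ψ₀ y = ⊤ := by
  obtain ⟨φ, c, hφ, hc⟩ :=
    geometric_hahn_banach_closed_point D.convex_polytope hD.compact.isClosed hy
  set w := (InnerProductSpace.toDual ℝ _).symm φ with hw
  have hwi : ∀ z, inner ℝ z w = φ z := fun z => by
    rw [real_inner_comm, hw, InnerProductSpace.toDual_symm_apply]
  rw [EReal.eq_top_iff_forall_lt]
  intro b
  set t : ℝ := (|b + ψ₀ 0| + 1) / (φ y - c) with ht
  have hpos : 0 < φ y - c := sub_pos.2 hc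
  have ht0 : 0 < t := by positivity
  refine lt_of_lt_of_le ?_ (coe_sub_le_symplecticPotential ψ₀ y (t • w))
  rw [EReal.coe_lt_coe_iff]
  have h1 := h.add_inner_gradient_le (t • w) 0
  have h2 := hφ _ (h.gradient_mem (t • w))
  rw [zero_sub, inner_neg_right, real_inner_smul_right, hwi] at h1
  rw [real_inner_smul_right, hwi]
  have h3 := mul_lt_mul_of_pos_left h2 ht0
  have h4 : t * (φ y - c) = |b + ψ₀ 0| + 1 := by rw [ht]; field_simp
  have := le_abs_self (b + ψ₀ 0)
  linarith

theorem mem_interior_of_pairing_le (h : IsToricKahlerPotential D ψ₀) (hD : D.IsDelzant)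
    {v : EuclideanSpace ℝ (Fin n) → ℝ} (hv : DifferentiableOn ℝ v D.polytope)
    {p : ℝ × EuclideanSpace ℝ (Fin n)} {y : EuclideanSpace ℝ (Fin n)} (hy : y ∈ D.polytope)
    (hmax : ∀ z ∈ D.polytope, pairing (realPotential ψ₀) v p z ≤ pairing (realPotential ψ₀) v p y) :
    y ∈ interior D.polytope := by
  obtain ⟨F, hF', hF⟩ := h.exists_realPotential_eq
  have hF1 : DifferentiableOn ℝ F D.polytope := hF'.differentiableOn (by simp)
  refine hD.mem_interior_of_isMinOn (g := fun z => F z + p.1 * v z - inner ℝ p.2 z) ?_ hy ?_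
  · have : Differentiable ℝ fun z : EuclideanSpace ℝ (Fin n) => (inner ℝ p.2 z : ℝ) :=
      (innerSL ℝ p.2).differentiable
    exact (hF1.add (hv.const_mul p.1)).sub this.differentiableOn
  · intro z hz
    have := hmax z hz
    rw [pairing, pairing, hF y hy, hF z hz] at this
    linarith

/-- The image of the gradient map is the interior of the polytope: `∇ψ₀ x` maximizes `⟨x, ·⟩ -
u₀`, so it is not on the boundary; conversely, for `y` in the interior, `ψ₀ - ⟨·, y⟩` is coercive
and has a critical point. -/
theorem range_gradient (h : IsToricKahlerPotential D ψ₀) (hD : D.IsDelzant) :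
    range (gradient ψ₀) = interior D.polytope := by
  refine Subset.antisymm ?_ fun y hy => ?_
  · rintro _ ⟨x, rfl⟩
    refine h.mem_interior_of_pairing_le hD (v := fun _ => 0) (p := (0, x))
      (differentiableOn_const 0) (h.gradient_mem x) fun z hz => ?_
    have h1 := h.inner_sub_le_realPotential hz x
    simp only [pairing, h.realPotential_gradient, real_inner_comm x,
      zero_mul] at h1 ⊢
    linarith
  · obtain ⟨r, hr, hball⟩ :=
      Metric.nhds_basis_closedBall.mem_iff.1 (mem_interior_iff_mem_nhds.1 hy)
    obtain ⟨C, hC⟩ := hD.compact.exists_bound_of_continuousOn h.continuousOn_realPotential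
    have hcoer : ∀ x, r * ‖x‖ - C ≤ ψ₀ x - inner ℝ x y := fun x =>
      norm_bound_of_closedBall hr.le hball (fun z hz => (le_abs_self _).trans (hC z hz))
        fun z hz => by
          have := h.inner_sub_le_realPotential hz x
          rw [real_inner_comm] at this
          linarith
    have hcont : Continuous fun x => ψ₀ x - inner ℝ x y :=
      h.smooth.continuous.sub (by fun_prop)
    obtain ⟨x, hx⟩ := hcont.exists_forall_le (tendsto_atTop_mono hcoer
      (tendsto_atTop_add_const_right _ _
        ((tendsto_norm_cocompact_atTop (E := EuclideanSpace ℝ (Fin n))).const_mul_atTop hr)))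
    refine ⟨x, (h.eq_gradient_of_affine_le fun z => ?_).symm⟩
    have := hx z
    rw [inner_sub_right, real_inner_comm z, real_inner_comm x]
    linarith

/-- The Legendre potential is finite, and it is the maximum over the polytope of the affine
functions `⟨x, y⟩ - u₀ y - s v y`. -/
theorem isPairingSup (h : IsToricKahlerPotential D ψ₀) (hD : D.IsDelzant)
    {v : EuclideanSpace ℝ (Fin n) → ℝ} (hv : ContinuousOn v D.polytope) :
    (∀ p, legendrePotential ψ₀ v p = ((legendrePotential ψ₀ v p).toReal : EReal)) ∧
    IsPairingSup D.polytope (realPotential ψ₀) v (fun p => (legendrePotential ψ₀ v p).toReal) := by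
  have hne : D.polytope.Nonempty := hD.interior_nonempty.mono interior_subset
  have key : ∀ p, ∃ y ∈ D.polytope,
      legendrePotential ψ₀ v p = (pairing (realPotential ψ₀) v p y : EReal) ∧
      ∀ z ∈ D.polytope, pairing (realPotential ψ₀) v p z ≤ pairing (realPotential ψ₀) v p y := by
    intro p
    have hc : ContinuousOn (pairing (realPotential ψ₀) v p) D.polytope :=
      (continuousOn_pairing h.continuousOn_realPotential hv).comp
        (f := fun y => (p, y)) (by fun_prop) fun y hy => ⟨mem_univ _, hy⟩
    obtain ⟨y, hy, hmax⟩ := hD.compact.exists_isMaxOn hne hc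
    have hterm : ∀ z ∈ D.polytope, ((inner ℝ p.2 z : ℝ) : EReal) -
        (symplecticPotential ψ₀ z + ((p.1 * v z : ℝ) : EReal))
        = (pairing (realPotential ψ₀) v p z : EReal) := fun z hz => by
      rw [h.coe_realPotential hz, ← EReal.coe_add, ← EReal.coe_sub, pairing]
    refine ⟨y, hy, le_antisymm (iSup_le fun z => ?_) ?_, fun z hz => hmax hz⟩
    · by_cases hz : z ∈ D.polytope
      · rw [hterm z hz, EReal.coe_le_coe_iff]
        exact hmax hz
      · beta_reduce
        rw [h.symplecticPotential_eq_top hD hz, EReal.top_add_coe, EReal.sub_top _]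
        exact bot_le
    · rw [← hterm y hy]
      exact le_iSup (fun z => ((inner ℝ p.2 z : ℝ) : EReal) -
        (symplecticPotential ψ₀ z + ((p.1 * v z : ℝ) : EReal))) y
  refine ⟨fun p => ?_, fun p => ?_, fun p z hz => ?_⟩
  all_goals obtain ⟨y, hy, hp, hmax⟩ := key p
  · rw [hp, EReal.toReal_coe]
  · exact ⟨y, hy, by rw [hp, EReal.toReal_coe]⟩
  · rw [hp, EReal.toReal_coe]
    exact hmax z hz

end IsToricKahlerPotential

/-! ### Null sets and sections in the dual space -/

section MeasureZero

variable {n : ℕ}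

theorem volume_graph_eq_zero {P : Set (EuclideanSpace ℝ (Fin n))} (hP : IsCompact P)
    {g : EuclideanSpace ℝ (Fin n) → ℝ} (hg : ContinuousOn g P) :
    volume ((fun y => (g y, y)) '' P) = 0 := by
  have hm : MeasurableSet ((fun y => (y, g y)) '' P) :=
    (hP.image_of_continuousOn (continuousOn_id.prodMk hg)).measurableSet
  have hz : (volume.prod volume) ((fun y => (y, g y)) '' P) = 0 := by
    rw [Measure.measure_prod_null hm]
    refine Filter.Eventually.of_forall fun y => ?_
    refine measure_mono_null (t := {g y}) ?_ (by simp)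
    rintro t ⟨z, -, hz⟩
    rw [Prod.mk.injEq] at hz
    rw [mem_singleton_iff, ← hz.2, hz.1]
  refine measure_mono_null ?_
    (Measure.measurePreserving_swap.quasiMeasurePreserving.preimage_null hz)
  rintro _ ⟨y, hy, rfl⟩
  exact ⟨y, hy, rfl⟩

/-- A set, measurable or not, whose sections over a neighbourhood of `y₀` contain nondegenerate
intervals has positive outer measure. -/
theorem volume_pos_of_sections {W : Set (ℝ × EuclideanSpace ℝ (Fin n))}
    {y₀ : EuclideanSpace ℝ (Fin n)} {α β : EuclideanSpace ℝ (Fin n) → ℝ}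
    (h : ∀ᶠ y in 𝓝 y₀, α y < β y ∧ ∀ σ ∈ Ioo (α y) (β y), (σ, y) ∈ W) : 0 < volume W := by
  refine pos_iff_ne_zero.2 fun hW => ?_
  have hz : (volume.prod volume) (Prod.swap ⁻¹' W : Set (EuclideanSpace ℝ (Fin n) × ℝ)) = 0 :=
    Measure.measurePreserving_swap.quasiMeasurePreserving.preimage_null hW
  have hae := ae_iff.1 (Measure.measure_ae_null_of_prod_null hz)
  refine (Measure.measure_pos_of_mem_nhds volume h).ne' (measure_mono_null ?_ hae)
  rintro y ⟨hlt, hy⟩ h0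
  have h1 : volume (Ioo (α y) (β y)) = 0 := measure_mono_null (fun σ hσ => hy σ hσ) h0
  rw [Real.volume_Ioo, ENNReal.ofReal_eq_zero] at h1
  linarith

end MeasureZero

/-! ### Convex lifespan, initial data and regularity -/

namespace IsToricKahlerPotential

variable {n : ℕ} {D : FacetData n} {ψ₀ ψ₀' u₀' : EuclideanSpace ℝ (Fin n) → ℝ}

theorem strictConvexOn_realPotential (h : IsToricKahlerPotential D ψ₀) (hD : D.IsDelzant) :
    StrictConvexOn ℝ (interior D.polytope) (realPotential ψ₀) := by
  refine ⟨D.convex_polytope.interior, fun y hy z hz hyz a b ha hb hab => ?_⟩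
  have hm := D.convex_polytope.interior hy hz ha.le hb.le hab
  rw [← h.range_gradient hD] at hm
  obtain ⟨x, hx⟩ := hm
  have h1 := h.inner_sub_le_realPotential (interior_subset hy) x
  have h2 := h.inner_sub_le_realPotential (interior_subset hz) x
  have hU := h.realPotential_gradient x
  rw [hx, inner_add_left, real_inner_smul_left, real_inner_smul_left] at hU
  rw [hU, smul_eq_mul, smul_eq_mul]
  have key : inner ℝ y x - ψ₀ x < realPotential ψ₀ y := by
    refine h1.lt_of_ne fun he => hyz ?_
    have hyx := (h.eq_gradient_of_realPotential_eq (interior_subset hy) he.symm).trans hx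
    have : b • (z - y) = 0 := by
      have ha' : a = 1 - b := by linarith
      rw [ha'] at hyx
      rw [smul_sub, sub_eq_zero]
      have h5 : y = y + (b • z - b • y) := hyx.trans (by module)
      exact sub_eq_zero.1 (left_eq_add.1 h5)
    rw [smul_eq_zero_iff_right hb.ne', sub_eq_zero] at this
    exact this.symm
  have h3 := mul_lt_mul_of_pos_left key ha
  have h4 := mul_le_mul_of_nonneg_left h2 hb.le
  have h5 : ψ₀ x = a * ψ₀ x + b * ψ₀ x := by rw [← add_mul, hab, one_mul]
  linarith

/-- On the interior of the polytope the function in the definition of the convex lifespan is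
`u₀ + s u₀'`. -/
theorem convexOn_lifespan_iff (h : IsToricKahlerPotential D ψ₀) (hD : D.IsDelzant)
    (hv : IsInitialVelocity D ψ₀ ψ₀' u₀') (s : ℝ) :
    ConvexOn ℝ (range (gradient ψ₀)) (fun y =>
      (symplecticPotential ψ₀ y).toReal - s * ψ₀' (Function.invFun (gradient ψ₀) y)) ↔
    ConvexOn ℝ (interior D.polytope) (fun y => realPotential ψ₀ y + s * u₀' y) := by
  have he : EqOn (fun y =>
      (symplecticPotential ψ₀ y).toReal - s * ψ₀' (Function.invFun (gradient ψ₀) y))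
      (fun y => realPotential ψ₀ y + s * u₀' y) (interior D.polytope) := by
    intro y hy
    rw [← h.range_gradient hD] at hy
    have h1 := hv.transform (Function.invFun (gradient ψ₀) y)
    rw [Function.invFun_eq hy] at h1
    simp only [h1, realPotential]
    ring
  rw [h.range_gradient hD]
  exact ⟨fun hc => hc.congr he, fun hc => hc.congr he.symm⟩

theorem exists_convexOn_of_lt_lifespan (h : IsToricKahlerPotential D ψ₀) (hD : D.IsDelzant)
    (hv : IsInitialVelocity D ψ₀ ψ₀' u₀') {s : ℝ} (hs : (s : EReal) < convexLifespan ψ₀ ψ₀') :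
    ∃ t, s < t ∧
      ConvexOn ℝ (interior D.polytope) (fun y => realPotential ψ₀ y + t * u₀' y) := by
  obtain ⟨_, ⟨t, ht, rfl⟩, hst⟩ := lt_sSup_iff.1 hs
  exact ⟨t, EReal.coe_lt_coe_iff.1 hst, (h.convexOn_lifespan_iff hD hv t).1 ht.2⟩

theorem not_convexOn_of_lifespan_lt (h : IsToricKahlerPotential D ψ₀) (hD : D.IsDelzant)
    (hv : IsInitialVelocity D ψ₀ ψ₀' u₀') {T : ℝ} (hT : convexLifespan ψ₀ ψ₀' < (T : EReal)) :
    0 < T ∧ ¬ ConvexOn ℝ (interior D.polytope) (fun y => realPotential ψ₀ y + T * u₀' y) := by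
  have hmem : ∀ s : ℝ, 0 ≤ s →
      ConvexOn ℝ (interior D.polytope) (fun y => realPotential ψ₀ y + s * u₀' y) → s < T := by
    intro s hs hc
    have : (s : EReal) ≤ convexLifespan ψ₀ ψ₀' :=
      le_sSup ⟨s, ⟨hs, (h.convexOn_lifespan_iff hD hv s).2 hc⟩, rfl⟩
    exact EReal.coe_lt_coe_iff.1 (this.trans_lt hT)
  have hT0 : 0 < T := hmem 0 le_rfl (by simpa using (h.strictConvexOn_realPotential hD).convexOn)
  exact ⟨hT0, fun hc => lt_irrefl T (hmem T hT0.le hc)⟩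

variable {f : ℝ × EuclideanSpace ℝ (Fin n) → ℝ}

theorem pairing_zero_gradient (h : IsToricKahlerPotential D ψ₀) (x : EuclideanSpace ℝ (Fin n)) :
    pairing (realPotential ψ₀) u₀' (0, x) (gradient ψ₀ x) = ψ₀ x := by
  simp only [pairing, h.realPotential_gradient, real_inner_comm x]
  ring

/-- Biconjugation: at time `0` the Legendre potential is `ψ₀`. -/
theorem pairingSup_zero (h : IsToricKahlerPotential D ψ₀)
    (hf : IsPairingSup D.polytope (realPotential ψ₀) u₀' f) (x : EuclideanSpace ℝ (Fin n)) :
    f (0, x) = ψ₀ x := by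
  refine le_antisymm ?_ (h.pairing_zero_gradient x ▸ hf.le (0, x) _ (h.gradient_mem x))
  obtain ⟨y, hy, hp⟩ := hf.exists_eq (0, x)
  have := h.inner_sub_le_realPotential hy x
  rw [real_inner_comm] at this
  rw [hp]
  simp only [pairing]
  linarith

theorem hasFDerivAt_pairingSup_zero (h : IsToricKahlerPotential D ψ₀) (hD : D.IsDelzant)
    (hv : ContinuousOn u₀' D.polytope)
    (hf : IsPairingSup D.polytope (realPotential ψ₀) u₀' f) (x : EuclideanSpace ℝ (Fin n)) :
    HasFDerivAt f (pairingSlope u₀' (gradient ψ₀ x)) (0, x) := by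
  refine hf.hasFDerivAt_of_unique hD.compact h.continuousOn_realPotential hv (h.gradient_mem x)
    (by rw [h.pairing_zero_gradient, h.pairingSup_zero hf]) fun z hz hzp => ?_
  rw [h.pairingSup_zero hf] at hzp
  refine h.eq_gradient_of_realPotential_eq hz ?_
  simp only [pairing] at hzp
  rw [real_inner_comm]
  linarith

theorem hasDerivWithinAt_pairingSup (h : IsToricKahlerPotential D ψ₀) (hD : D.IsDelzant)
    (hv : IsInitialVelocity D ψ₀ ψ₀' u₀')
    (hf : IsPairingSup D.polytope (realPotential ψ₀) u₀' f) (x : EuclideanSpace ℝ (Fin n)) :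
    HasDerivWithinAt (fun s : ℝ => f (s, x)) (ψ₀' x) (Ici 0) 0 := by
  have h1 := h.hasFDerivAt_pairingSup_zero hD hv.smooth.continuousOn hf x
  have h2 : HasDerivAt (fun s : ℝ => (s, x)) (1, 0) 0 :=
    (hasDerivAt_id 0).prodMk (hasDerivAt_const 0 x)
  refine ((h1.comp_hasDerivAt 0 h2).congr_deriv ?_).hasDerivWithinAt
  rw [pairingSlope_apply, hv.transform]
  simp

/-- Before a time `t` of convexity the potential `u₀ + s u₀'` is strictly convex in the interior, as
a combination of `u₀` and `u₀ + t u₀'`. Maximizers are interior, so they are unique, and Danskin's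
theorem applies. -/
theorem differentiableAt_pairingSup (h : IsToricKahlerPotential D ψ₀) (hD : D.IsDelzant)
    (hv : ContDiffOn ℝ ∞ u₀' D.polytope)
    (hf : IsPairingSup D.polytope (realPotential ψ₀) u₀' f)
    {p : ℝ × EuclideanSpace ℝ (Fin n)} (hp : 0 ≤ p.1) {t : ℝ} (ht : p.1 < t)
    (hc : ConvexOn ℝ (interior D.polytope) (fun y => realPotential ψ₀ y + t * u₀' y)) :
    DifferentiableAt ℝ f p := by
  have hint : ∀ y ∈ D.polytope, f p = pairing (realPotential ψ₀) u₀' p y →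
      y ∈ interior D.polytope := fun y hy hpy =>
    h.mem_interior_of_pairing_le hD (hv.differentiableOn (by simp)) hy
      fun z hz => hpy ▸ hf.le p z hz
  obtain ⟨y, hy, hpy⟩ := hf.exists_eq p
  refine (hf.hasFDerivAt_of_unique hD.compact h.continuousOn_realPotential hv.continuousOn hy hpy
    fun z hz hpz => ?_).differentiableAt
  by_contra hne
  have hyi := hint y hy hpy
  have hzi := hint z hz hpz
  have h2 : (0 : ℝ) < 1 / 2 := by norm_num
  have hstrict := (h.strictConvexOn_realPotential hD).2 hzi hyi hne h2 h2 (by norm_num)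
  have hconv := hc.2 hzi hyi h2.le h2.le (by norm_num)
  have hle := hf.le p _ (D.convex_polytope hz hy h2.le h2.le (by norm_num))
  -- `t (u₀ + s u₀') = (t - s) u₀ + s (u₀ + t u₀')` with `s = p.1 < t`.
  have h3 := mul_lt_mul_of_pos_left hstrict (sub_pos.2 ht)
  have h4 := mul_le_mul_of_nonneg_left hconv hp
  have h5 := mul_le_mul_of_nonneg_left hle (hp.trans ht.le)
  have h6 : t * f p = t * pairing (realPotential ψ₀) u₀' p y := by rw [hpy]
  have h7 : t * f p = t * pairing (realPotential ψ₀) u₀' p z := by rw [hpz]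
  simp only [pairing, inner_add_right, real_inner_smul_right, smul_eq_mul] at h3 h4 h5 h6 h7
  linarith

end IsToricKahlerPotential

/-! ### The Monge-Ampère measure -/

section Subdifferential

variable {n : ℕ} {P : Set (EuclideanSpace ℝ (Fin n))} {u v : EuclideanSpace ℝ (Fin n) → ℝ}
  {φ : ℝ × EuclideanSpace ℝ (Fin n) → EReal}

theorem mem_subdiff_iff (hφ : ∀ p, φ p = ((φ p).toReal : EReal))
    {p w : ℝ × EuclideanSpace ℝ (Fin n)} :
    w ∈ subdiff φ p ↔ ∀ z : ℝ × EuclideanSpace ℝ (Fin n),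
      (φ p).toReal + (w.1 * (z.1 - p.1) + inner ℝ w.2 (z.2 - p.2)) ≤ (φ z).toReal := by
  have hfin : φ p ≠ ⊤ ∧ φ p ≠ ⊥ := by
    rw [hφ p]
    exact ⟨EReal.coe_ne_top _, EReal.coe_ne_bot _⟩
  refine ⟨fun hw z => ?_, fun hw => ⟨hfin.1, hfin.2, fun z => ?_⟩⟩
  · have := hw.2.2 z
    rw [hφ p, hφ z, ← EReal.coe_add, EReal.coe_le_coe_iff] at this
    exact this
  · rw [hφ p, hφ z, ← EReal.coe_add, EReal.coe_le_coe_iff]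
    exact hw z

/-- At a regular point the only subgradient is `(-v y, y)` with `y` the maximizer, so the image of
the regular locus lies in the graph of `-v` over the compact set `P`. -/
theorem mongeAmpere_regularLocus (hφ : ∀ p, φ p = ((φ p).toReal : EReal))
    (hf : IsPairingSup P u v (fun p => (φ p).toReal)) (hP : IsCompact P)
    (hv : ContinuousOn v P) : mongeAmpere φ (regularLocus φ) = 0 := by
  refine measure_mono_null ?_ (volume_graph_eq_zero hP hv.neg)
  refine iUnion₂_subset fun p hp w hw => ?_
  rw [mem_subdiff_iff hφ] at hw
  obtain ⟨y, hy, hpy⟩ := hf.exists_eq p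
  have h1 := fderiv_eq_of_affine_le hp.2.2 (hf.add_slope_le hy hpy)
  have h2 := fderiv_eq_of_affine_le hp.2.2 (ℓ := pairingSlope (fun _ => -w.1) w.2) fun z => by
    rw [pairingSlope_apply, neg_neg]
    exact hw z
  have h3 : ∀ q : ℝ × EuclideanSpace ℝ (Fin n),
      -(v y) * q.1 + inner ℝ y q.2 = w.1 * q.1 + inner ℝ w.2 q.2 := fun q => by
    have := congrArg (fun ℓ => ℓ q) (h1.symm.trans h2)
    simpa only [pairingSlope_apply, neg_neg] using this
  refine ⟨y, hy, Prod.ext ?_ ?_⟩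
  · simpa using h3 (1, 0)
  · exact ext_inner_right ℝ fun x => by simpa using h3 (0, x)

theorem mongeAmpere_slab_eq_singularLocus (hreg : mongeAmpere φ (regularLocus φ) = 0) (T : ℝ) :
    mongeAmpere φ (Icc 0 T ×ˢ univ) = mongeAmpere φ (singularLocus φ T) := by
  refine le_antisymm ?_ (measure_mono (biUnion_subset_biUnion_left inter_subset_right))
  have hsub : (⋃ p ∈ Icc 0 T ×ˢ (univ : Set (EuclideanSpace ℝ (Fin n))), subdiff φ p) ⊆
      (⋃ p ∈ regularLocus φ, subdiff φ p) ∪ ⋃ p ∈ singularLocus φ T, subdiff φ p := by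
    rw [← biUnion_union]
    refine biUnion_subset_biUnion_left fun p hp => ?_
    by_cases hr : p ∈ regularLocus φ
    · exact Or.inl hr
    · exact Or.inr ⟨⟨⟨hp.1.1, mem_univ _⟩, hr⟩, hp⟩
  refine (measure_mono hsub).trans ((measure_union_le _ _).trans ?_)
  rw [show volume (⋃ p ∈ regularLocus φ, subdiff φ p) = 0 from hreg, zero_add]
  exact le_rfl

/-- If `g = u + T v` is not convex, then near some `y₀` it exceeds its convex envelope by a positive
amount, at least `gap y`, and every `σ` in an interval of length `gap y / T` above `-v y` gives a
subgradient `(σ, y)` in the slab. -/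
theorem mongeAmpere_slab_pos (hφ : ∀ p, φ p = ((φ p).toReal : EReal))
    (hf : IsPairingSup P u v (fun p => (φ p).toReal)) (hP : IsCompact P) (hPc : Convex ℝ P)
    (hu : ContinuousOn u P) (hv : ContinuousOn v P)
    (h0 : ∀ y ∈ interior P, ∃ x, (φ (0, x)).toReal = pairing u v (0, x) y) {T : ℝ} (hT : 0 < T)
    (hconv : ¬ ConvexOn ℝ (interior P) (fun y => u y + T * v y)) :
    0 < mongeAmpere φ (Icc 0 T ×ˢ univ) := by
  set g : EuclideanSpace ℝ (Fin n) → ℝ := fun y => u y + T * v y with hg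
  have hgc : ∀ y ∈ interior P, ContinuousAt g y := fun y hy =>
    (hu.add (hv.const_mul T)).continuousAt (mem_interior_iff_mem_nhds.1 hy)
  obtain ⟨y₁, hy₁, y₂, hy₂, a, b, ha, hb, hab, hlt⟩ : ∃ y₁ ∈ interior P, ∃ y₂ ∈ interior P,
      ∃ a b : ℝ, 0 ≤ a ∧ 0 ≤ b ∧ a + b = 1 ∧ a * g y₁ + b * g y₂ < g (a • y₁ + b • y₂) := by
    by_contra! hcon
    exact hconv ⟨hPc.interior, fun y hy z hz a b ha hb hab => hcon y hy z hz a b ha hb hab⟩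
  set y₀ := a • y₁ + b • y₂ with hy₀
  have hy₀i : y₀ ∈ interior P := hPc.interior hy₁ hy₂ ha hb hab
  have hshift : ∀ z, Tendsto (fun y => z + (y - y₀)) (𝓝 y₀) (𝓝 z) := fun z => by
    have : Continuous fun y => z + (y - y₀) := by fun_prop
    simpa using this.tendsto y₀
  -- A chord violating convexity at `y₀` is translated along with `y`.
  set gap : EuclideanSpace ℝ (Fin n) → ℝ := fun y =>
    g y - (a * g (y₁ + (y - y₀)) + b * g (y₂ + (y - y₀))) with hgap
  have hgapc : Tendsto gap (𝓝 y₀) (𝓝 (g y₀ - (a * g y₁ + b * g y₂))) :=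
    (hgc y₀ hy₀i).tendsto.sub
      ((((hgc y₁ hy₁).tendsto.comp (hshift y₁)).const_mul a).add
        (((hgc y₂ hy₂).tendsto.comp (hshift y₂)).const_mul b))
  refine volume_pos_of_sections (y₀ := y₀) (α := fun y => -v y) (β := fun y => -v y + gap y / T) ?_
  filter_upwards [hgapc.eventually_const_lt (sub_pos.2 hlt), isOpen_interior.mem_nhds hy₀i,
    (hshift y₁).eventually (isOpen_interior.mem_nhds hy₁),
    (hshift y₂).eventually (isOpen_interior.mem_nhds hy₂)] with y hpos hy hz₁ hz₂
  refine ⟨lt_add_of_pos_right _ (div_pos hpos hT), fun σ hσ => ?_⟩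
  obtain ⟨x₀, hx₀⟩ := h0 y hy
  have henv : ∀ x, T * σ - u y ≤ (φ (T, x)).toReal - inner ℝ x y := by
    intro x
    have h1 := mul_le_mul_of_nonneg_left (hf.le (T, x) _ (interior_subset hz₁)) ha
    have h2 := mul_le_mul_of_nonneg_left (hf.le (T, x) _ (interior_subset hz₂)) hb
    have h3 : T * (σ + v y) < gap y := by
      have := hσ.2
      rw [← lt_div_iff₀' hT]
      linarith
    have h4 : inner ℝ x y = a * inner ℝ x (y₁ + (y - y₀)) + b * inner ℝ x (y₂ + (y - y₀)) := by
      rw [← real_inner_smul_right, ← real_inner_smul_right, ← inner_add_right]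
      congr 1
      have hb' : b = 1 - a := by linarith
      rw [hy₀, hb']
      module
    have h5 : (φ (T, x)).toReal = a * (φ (T, x)).toReal + b * (φ (T, x)).toReal := by
      rw [← add_mul, hab, one_mul]
    simp only [pairing] at h1 h2
    simp only [hgap, hg] at h3
    linarith
  obtain ⟨p, hp, hsub⟩ := hf.exists_subgradient hP hu hv hy hx₀ hT hσ.1.le henv
  exact mem_iUnion₂.2 ⟨p, hp, (mem_subdiff_iff hφ).2 hsub⟩

end Subdifferential

theorem theorem1 {n : ℕ} (D : FacetData n) (hD : D.IsDelzant)
    (ψ₀ ψ₀' u₀' : EuclideanSpace ℝ (Fin n) → ℝ)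
    (hψ₀ : IsToricKahlerPotential D ψ₀) (hu₀' : IsInitialVelocity D ψ₀ ψ₀' u₀') :
    ((∀ p, legendrePotential ψ₀ u₀' p ≠ ⊤ ∧ legendrePotential ψ₀ u₀' p ≠ ⊥) ∧
      ConvexOn ℝ Set.univ (fun p => (legendrePotential ψ₀ u₀' p).toReal)) ∧
    (HasCauchyData (legendrePotential ψ₀ u₀') ψ₀ ψ₀' ∧
      mongeAmpere (legendrePotential ψ₀ u₀') (regularLocus (legendrePotential ψ₀ u₀')) = 0 ∧
      {p | 0 ≤ p.1 ∧ (p.1 : EReal) < convexLifespan ψ₀ ψ₀'} ⊆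
        regularLocus (legendrePotential ψ₀ u₀')) ∧
    (∀ T : ℝ, convexLifespan ψ₀ ψ₀' < (T : EReal) →
      ¬ IsWeakSolution (legendrePotential ψ₀ u₀') ψ₀ ψ₀' T ∧
      mongeAmpere (legendrePotential ψ₀ u₀') (Set.Icc 0 T ×ˢ Set.univ) =
        mongeAmpere (legendrePotential ψ₀ u₀') (singularLocus (legendrePotential ψ₀ u₀') T) ∧
      0 < mongeAmpere (legendrePotential ψ₀ u₀')
        (singularLocus (legendrePotential ψ₀ u₀') T)) := by
  have hv := hu₀'.smooth.continuousOn
  have hU := hψ₀.continuousOn_realPotential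
  obtain ⟨hcoe, hf⟩ := hψ₀.isPairingSup hD hv
  have hfin : ∀ p, legendrePotential ψ₀ u₀' p ≠ ⊤ ∧ legendrePotential ψ₀ u₀' p ≠ ⊥ := fun p => by
    rw [hcoe p]
    exact ⟨EReal.coe_ne_top _, EReal.coe_ne_bot _⟩
  have hreg := mongeAmpere_regularLocus hcoe hf hD.compact hv
  refine ⟨⟨hfin, hf.convexOn⟩, ⟨fun x => ⟨?_, ?_⟩, hreg, fun p hp => ?_⟩, fun T hT => ?_⟩
  · rw [hcoe, hψ₀.pairingSup_zero hf x]
  · exact hψ₀.hasDerivWithinAt_pairingSup hD hu₀' hf x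
  · obtain ⟨t, ht, hc⟩ := hψ₀.exists_convexOn_of_lt_lifespan hD hu₀' hp.2
    exact ⟨hp.1, Filter.Eventually.of_forall hfin,
      hψ₀.differentiableAt_pairingSup hD hu₀'.smooth hf hp.1 ht hc⟩
  · obtain ⟨hT0, hnc⟩ := hψ₀.not_convexOn_of_lifespan_lt hD hu₀' hT
    have hpos := mongeAmpere_slab_pos hcoe hf hD.compact D.convex_polytope hU hv
      (fun y hy => by
        rw [← hψ₀.range_gradient hD] at hy
        obtain ⟨x, rfl⟩ := hy
        exact ⟨x, by rw [hψ₀.pairing_zero_gradient, hψ₀.pairingSup_zero hf]⟩) hT0 hnc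
    have heq := mongeAmpere_slab_eq_singularLocus hreg T
    exact ⟨fun hw => hpos.ne' hw.1, heq, heq ▸ hpos⟩
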